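/- For a finite sequence $\vec u=(u_0,\dots,u_{t-1})$ of positive integers and $n\ge 0$, let $\mathrm{PowG}^t_{t+n}(\vec u)$ be the following game of two players, Challenger and Powerator, with $t+n$ rounds, of which the first $t$ are fixed: Powerator's responses in them are $u_0,\dots,u_{t-1}$. In each round $i$ with $t\le i<t+n$, Challenger picks a positive integer $x_i$, and Powerator responds with a positive integer $u_i$ such that $u_i\le x_i<2u_i$. Challenger wins if $u_iu_j<u_h<2u_iu_j$ for some (not necessarily distinct) $h,i,j<t+n$; otherwise Powerator wins. The $\mathrm{PowG}$-complexity $c(\vec u)\in\mathbb N\cup\{\infty\}$ is the least $n\ge0$ such that Challenger has a winning strategy in $\mathrm{PowG}^t_{t+n}(\vec u)$, and $c(\vec u)=\infty$ if there is no such $n$. For a positive integer $u$, $c(u)$ is the complexity of the one-term sequence $(u)$. Then for all integers $k\ge0$, $$k+1\le c\bigl(6^{(2^{2^k})!}\bigr)\le k+4.$$ Consequently, $c$ is unbounded on the positive integers that are not powers of $2$ (where $1=2^0$ counts as a power of $2$), and on these integers it takes exactly the positive integer values: $$\{c(u): u\in\mathbb N_{>0},\ u\text{ is not a power of }2\}=\mathbb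 N_{>0}.$$ -/

import Mathlib

namespace PowG

/-- The winning condition of Challenger in the power-of-2 game on the positive integers, as a
property of the list `u` of all responses of Powerator: `u_i u_j < u_h < 2 u_i u_j` for some
(not necessarily distinct) indices `h, i, j`. -/
def ChallengerWins (u : List ℕ) : Prop :=
  ∃ i j h : Fin u.length, u[i] * u[j] < u[h] ∧ u[h] < 2 * (u[i] * u[j])

/-- A strategy of Challenger: it maps the list of all responses of Powerator so far (including the
responses fixed in advance) to the next move, a positive integer. The earlier moves of Challenger
are determined by the strategy and by the responses, so they need not be arguments. -/
structure Strategy where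
  move : List ℕ → ℕ
  move_pos : ∀ p, 0 < move p

/-- `w` is a list of legal responses of Powerator to the strategy `σ`, starting from the position
where the responses `u` are fixed: each response `w_i` to the move `x` satisfies
`w_i ≤ x < 2 w_i` (so that `w_i > 0`). -/
def Strategy.LegalResponses (σ : Strategy) (u w : List ℕ) : Prop :=
  ∀ i : Fin w.length,
    w[i] ≤ σ.move (u ++ w.take i) ∧ σ.move (u ++ w.take i) < 2 * w[i]

/-- The strategy `σ` of Challenger is winning in the game of `t + n` rounds, in which the first `t`
responses of Powerator are fixed as `u` (where `t` is the length of `u`): Challenger wins against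
all legal responses of Powerator in the remaining `n` rounds. -/
def Strategy.IsWinning (σ : Strategy) (u : List ℕ) (n : ℕ) : Prop :=
  ∀ w : List ℕ, w.length = n → σ.LegalResponses u w → ChallengerWins (u ++ w)

/-- The complexity of a list `u` of positive integers: the least `n` such that Challenger has a
winning strategy in the game of `t + n` rounds with the first `t` responses fixed as `u`, and
`⊤` (infinity) if there is no such `n`. -/
noncomputable def complexity (u : List ℕ) : ℕ∞ :=
  sInf {m : ℕ∞ | ∃ n : ℕ, m = (n : ℕ∞) ∧ ∃ σ : Strategy, σ.IsWinning u n}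

end PowG

namespace PowG

/-! Optimal play is captured by the recursive predicate `Win`, with `complexity u ≤ n ↔ Win n u`.
Upper bound. Answering `2 * y - 1`, Powerator must give `y` or some `z` with `y < z < 2 * y`; hence
Challenger can split a product `y ^ D * v ^ r` at `y`, and whichever answer comes, one of two
shorter products is violated. Division of exponents by `D` reduces exponents below `D ^ 2` to
exponents below `D`, so about `k` rounds handle exponents up to about `2 ^ 2 ^ k` (`win_of_pow`). A
number `u` that is not of the form `v ^ p * 2 ^ s`, with `p` below `2 * 2 ^ 2 ^ k`, is brought to
such a violation in a few moves (`win_of_ne_pow_mul_two_pow`). For `6 ^ N` with `N = (2 ^ 2 ^ k)!`,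
Bertrand's postulate supplies a prime `p` that does not divide `N`. Lower bound. Powerator answers
only with numbers `2 ^ a * 3 ^ b`, that is, with vectors `(a, b)`, and keeps the following invariant
(`Inv`): every short integer combination of the vectors with positive second coordinate has a large
first coordinate. With no rounds left, a quotient `u_h / (u_i u_j)` is then a power of `2`, at least
`3` or at most `1 / 3`. One round squares the required length of the combinations
(`Inv.exists_cons`), and the factorial pays for the divisibility and the gaps. No value is skipped:
by moving near the square root of `u`, Challenger wins at once, wins in two more rounds, or obtains
a smaller number that is not a power of `2`. So the least `u` that resists `n` rounds falls in `n +
1` (`exists_complexity_eq`). -/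

/-! ### The game as a recursion on the number of rounds left -/

theorem challengerWins_iff {l : List ℕ} :
    ChallengerWins l ↔ ∃ a ∈ l, ∃ b ∈ l, ∃ c ∈ l, a * b < c ∧ c < 2 * (a * b) := by
  constructor
  · rintro ⟨i, j, h, h1, h2⟩
    exact ⟨_, List.getElem_mem i.2, _, List.getElem_mem j.2, _, List.getElem_mem h.2, h1, h2⟩
  · rintro ⟨a, ha, b, hb, c, hc, h1, h2⟩
    obtain ⟨i, hi, rfl⟩ := List.getElem_of_mem ha
    obtain ⟨j, hj, rfl⟩ := List.getElem_of_mem hb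
    obtain ⟨h, hh, rfl⟩ := List.getElem_of_mem hc
    exact ⟨⟨i, hi⟩, ⟨j, hj⟩, ⟨h, hh⟩, h1, h2⟩

/-- Challenger can win from the position `l` in `n` more rounds. -/
def Win : ℕ → List ℕ → Prop
  | 0, l => ChallengerWins l
  | n + 1, l => ∃ x, 0 < x ∧ ∀ r, r ≤ x → x < 2 * r → Win n (l ++ [r])

theorem Strategy.legalResponses_nil (σ : Strategy) (u : List ℕ) : σ.LegalResponses u [] :=
  fun i => i.elim0

theorem Strategy.legalResponses_cons (σ : Strategy) (u : List ℕ) (r : ℕ) (w : List ℕ) :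
    σ.LegalResponses u (r :: w) ↔
      (r ≤ σ.move u ∧ σ.move u < 2 * r) ∧ σ.LegalResponses (u ++ [r]) w := by
  constructor
  · intro h
    refine ⟨by simpa using h ⟨0, by simp⟩, fun i => ?_⟩
    have := h ⟨i + 1, by simp⟩
    simpa using this
  · rintro ⟨h0, h⟩ ⟨i, hi⟩
    cases i with
    | zero => simpa using h0
    | succ i =>
      have := h ⟨i, by simpa using hi⟩
      simpa using this

theorem Strategy.isWinning_succ {σ : Strategy} {u : List ℕ} {n : ℕ} :
    σ.IsWinning u (n + 1) ↔
      ∀ r, r ≤ σ.move u → σ.move u < 2 * r → σ.IsWinning (u ++ [r]) n := by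
  constructor
  · intro h r h1 h2 w hw hl
    have := h (r :: w) (by simp [hw]) ((σ.legalResponses_cons u r w).2 ⟨⟨h1, h2⟩, hl⟩)
    simpa using this
  · intro h w hw hl
    cases w with
    | nil => simp at hw
    | cons r w =>
      obtain ⟨⟨h1, h2⟩, h3⟩ := (σ.legalResponses_cons u r w).1 hl
      have := h r h1 h2 w (by simpa using hw) h3
      simpa using this

/-- A strategy only matters on the positions that extend the current one. -/
theorem Strategy.IsWinning.congr {σ τ : Strategy} {n : ℕ} :
    ∀ {u : List ℕ}, (∀ w, σ.move (u ++ w) = τ.move (u ++ w)) → σ.IsWinning u n →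
      τ.IsWinning u n := by
  intro u h hσ w hw hl
  refine hσ w hw fun i => ?_
  have := hl i
  rwa [← h] at this

theorem exists_isWinning_iff {n : ℕ} : ∀ {u : List ℕ},
    (∃ σ : Strategy, σ.IsWinning u n) ↔ Win n u := by
  induction n with
  | zero =>
    intro u
    constructor
    · rintro ⟨σ, h⟩
      have := h [] rfl (σ.legalResponses_nil u)
      rwa [List.append_nil] at this
    · intro h
      refine ⟨⟨fun _ => 1, fun _ => one_pos⟩, fun w hw _ => ?_⟩
      rw [List.length_eq_zero_iff] at hw
      subst hw
      rwa [List.append_nil]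
  | succ n ih =>
    intro u
    constructor
    · rintro ⟨σ, h⟩
      exact ⟨σ.move u, σ.move_pos u, fun r h1 h2 =>
        ih.1 ⟨σ, Strategy.isWinning_succ.1 h r h1 h2⟩⟩
    · rintro ⟨x, hx, h⟩
      have : ∀ r, ∃ σ : Strategy, r ≤ x → x < 2 * r → σ.IsWinning (u ++ [r]) n := by
        intro r
        by_cases hr : r ≤ x ∧ x < 2 * r
        · obtain ⟨σ, hσ⟩ := ih.2 (h r hr.1 hr.2)
          exact ⟨σ, fun _ _ => hσ⟩
        · exact ⟨⟨fun _ => 1, fun _ => one_pos⟩, fun h1 h2 => absurd ⟨h1, h2⟩ hr⟩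
      choose τ hτ using this
      let σ : Strategy :=
        -- The entry at index `u.length` is the answer to the first free move: it selects the
        -- strategy `τ r`, and while it is absent the move is `x`.
        { move := fun p => (p[u.length]?).elim x fun r => (τ r).move p
          move_pos := by
            intro p
            cases p[u.length]? with
            | none => exact hx
            | some r => exact (τ r).move_pos p }
      have h0 : σ.move u = x := by simp [σ]
      refine ⟨σ, Strategy.isWinning_succ.2 fun r h1 h2 => ?_⟩
      rw [h0] at h1 h2
      exact (hτ r h1 h2).congr fun w => by simp [σ]

theorem Win.mono {n : ℕ} : ∀ {l l' : List ℕ}, l ⊆ l' → Win n l → Win n l' := by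
  induction n with
  | zero =>
    intro l l' h hw
    obtain ⟨a, ha, b, hb, c, hc, h'⟩ := challengerWins_iff.1 hw
    exact challengerWins_iff.2 ⟨a, h ha, b, h hb, c, h hc, h'⟩
  | succ n ih =>
    rintro l l' h ⟨x, hx, hw⟩
    exact ⟨x, hx, fun r h1 h2 =>
      ih (List.append_subset.2 ⟨fun _ ha => List.mem_append_left _ (h ha), by simp⟩) (hw r h1 h2)⟩

theorem Win.play {n : ℕ} {l : List ℕ} {x : ℕ} (hx : 0 < x)
    (h : ∀ r, r ≤ x → x < 2 * r → Win n (r :: l)) : Win (n + 1) l :=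
  ⟨x, hx, fun r h1 h2 => (h r h1 h2).mono (by intro a; simp; tauto)⟩

theorem Win.succ {n : ℕ} : ∀ {l : List ℕ}, Win n l → Win (n + 1) l := by
  induction n with
  | zero => exact fun h => ⟨1, one_pos, fun r _ _ => h.mono (by simp)⟩
  | succ n ih => exact fun ⟨x, hx, h⟩ => ⟨x, hx, fun r h1 h2 => ih (h r h1 h2)⟩

theorem Win.of_le {m n : ℕ} (h : m ≤ n) {l : List ℕ} (hw : Win m l) : Win n l := by
  induction h with
  | refl => exact hw
  | step _ ih => exact ih.succ

theorem win_of_mem {l : List ℕ} {a b c : ℕ} (ha : a ∈ l) (hb : b ∈ l) (hc : c ∈ l)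
    (h1 : a * b < c) (h2 : c < 2 * (a * b)) (n : ℕ) : Win n l :=
  Win.of_le (Nat.zero_le n) (challengerWins_iff.2 ⟨a, ha, b, hb, c, hc, h1, h2⟩)

theorem complexity_le_iff {u : List ℕ} {n : ℕ} : complexity u ≤ n ↔ Win n u := by
  constructor
  · intro h
    by_contra hw
    have : ((n + 1 : ℕ) : ℕ∞) ≤ complexity u := by
      refine le_sInf ?_
      rintro _ ⟨m, rfl, hm⟩
      rw [exists_isWinning_iff] at hm
      by_contra hlt
      push Not at hlt
      exact hw (hm.of_le (by have := Nat.cast_lt.1 hlt; omega))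
    have := Nat.cast_le.1 (this.trans h)
    omega
  · exact fun h => sInf_le ⟨n, rfl, exists_isWinning_iff.2 h⟩

theorem lt_complexity_iff {u : List ℕ} {n : ℕ} : (n : ℕ∞) < complexity u ↔ ¬ Win n u := by
  rw [← complexity_le_iff, not_le]

theorem succ_le_complexity {u : List ℕ} {n : ℕ} (h : ¬ Win n u) :
    ((n + 1 : ℕ) : ℕ∞) ≤ complexity u := by
  have := Order.add_one_le_of_lt (lt_complexity_iff.2 h)
  simpa using this

/-! ### Strategies of Challenger -/

/-- Challenger can force the response `y` if every response strictly between `y` and `2 * y` is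
losing for Powerator. -/
theorem Win.force {n : ℕ} {l : List ℕ} {y : ℕ} (hy : 0 < y) (h : Win n (y :: l))
    (h' : ∀ z, y < z → z < 2 * y → Win n (z :: l)) : Win (n + 1) l := by
  refine Win.play (x := 2 * y - 1) (by omega) fun r h1 h2 => ?_
  obtain rfl | hlt : y = r ∨ y < r := by omega
  · exact h
  · exact h' r hlt (by omega)

theorem two_pow_two_pow_succ (m : ℕ) : 2 ^ 2 ^ (m + 1) = 2 ^ 2 ^ m * 2 ^ 2 ^ m := by
  rw [← pow_add, pow_succ]
  ring_nf

/-- With `D = 2 ^ 2 ^ m`, the product `z ^ (D * D) * v ^ c` equals `y ^ D * v ^ (c % D)` for `y = z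
^ D * v ^ (c / D)`. Forcing `y` leaves the violation by `w`; any other answer itself violates the
product defining `y`. Both are instances with `m` in place of `m + 1`. -/
theorem win_of_pow_mul_pow {m : ℕ} : ∀ {l : List ℕ} {z v w c : ℕ}, z ∈ l → v ∈ l → w ∈ l →
    0 < z → 0 < v → c < 2 ^ 2 ^ m → z ^ 2 ^ 2 ^ m * v ^ c < w → w < 2 * (z ^ 2 ^ 2 ^ m * v ^ c) →
    Win (m + 1) l := by
  induction m with
  | zero =>
    intro l z v w c hz hv hw hz0 hv0 hc h1 h2
    norm_num at hc h1 h2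
    obtain rfl | rfl : c = 0 ∨ c = 1 := by omega
    · exact win_of_mem hz hz hw (by nlinarith) (by nlinarith) _
    · refine Win.force (y := z * z) (by positivity) ?_ fun t ht1 ht2 => ?_
      · exact win_of_mem (a := z * z) (b := v) (c := w) (by simp) (by simp [hv]) (by simp [hw])
          (by nlinarith) (by nlinarith) _
      · exact win_of_mem (a := z) (b := z) (c := t) (by simp [hz]) (by simp [hz]) (by simp)
          ht1 ht2 _
  | succ m ih =>
    intro l z v w c hz hv hw hz0 hv0 hc h1 h2
    set D := 2 ^ 2 ^ m with hD
    have hDpos : 0 < D := by positivity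
    rw [two_pow_two_pow_succ, ← hD] at hc h1 h2
    have key : z ^ (D * D) * v ^ c = (z ^ D * v ^ (c / D)) ^ D * v ^ (c % D) := by
      conv_lhs => rw [← Nat.div_add_mod c D]
      rw [pow_add, mul_pow, ← pow_mul, ← pow_mul, mul_comm D (c / D), mul_assoc]
    rw [key] at h1 h2
    refine Win.force (y := z ^ D * v ^ (c / D)) (by positivity) ?_ fun t ht1 ht2 => ?_
    · exact ih (z := z ^ D * v ^ (c / D)) (v := v) (w := w) (c := c % D) (by simp) (by simp [hv])
        (by simp [hw]) (by positivity) hv0 (Nat.mod_lt _ hDpos) h1 h2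
    · exact ih (z := z) (v := v) (w := t) (c := c / D) (by simp [hz]) (by simp [hv]) (by simp)
        hz0 hv0 (Nat.div_lt_of_lt_mul hc) ht1 ht2

theorem win_of_pow {m : ℕ} : ∀ {l : List ℕ} {v w c : ℕ}, v ∈ l → w ∈ l → 0 < v → 0 < c →
    c < 2 * 2 ^ 2 ^ m → v ^ c < w → w < 2 * v ^ c → Win (m + 1) l := by
  induction m with
  | zero =>
    intro l v w c hv hw hv0 hc0 hc h1 h2
    obtain hge | rfl : 2 ≤ c ∨ c = 1 := by omega
    · have e : v ^ c = v ^ 2 ^ 2 ^ 0 * v ^ (c - 2) := by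
        rw [← pow_add]; congr 1; norm_num; omega
      rw [e] at h1 h2
      exact win_of_pow_mul_pow hv hv hw hv0 hv0 (by norm_num at hc ⊢; omega) h1 h2
    -- The violation `v < w < 2 * v` becomes one of products once `1` is on the list.
    · refine Win.force (y := 1) one_pos ?_ fun t _ _ => by omega
      exact win_of_mem (a := 1) (b := v) (c := w) (by simp) (by simp [hv]) (by simp [hw])
        (by simpa using h1) (by simpa using h2) _
  | succ m ih =>
    intro l v w c hv hw hv0 hc0 hc h1 h2
    by_cases hge : 2 ^ 2 ^ (m + 1) ≤ c
    · have e : v ^ c = v ^ 2 ^ 2 ^ (m + 1) * v ^ (c - 2 ^ 2 ^ (m + 1)) := by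
        rw [← pow_add]; congr 1; omega
      rw [e] at h1 h2
      exact win_of_pow_mul_pow hv hv hw hv0 hv0 (by omega) h1 h2
    · set D := 2 ^ 2 ^ m with hD
      have hDpos : 0 < D := by positivity
      rw [two_pow_two_pow_succ, ← hD, not_le] at hge
      by_cases hlt : c < 2 * D
      · exact (ih hv hw hv0 hc0 hlt h1 h2).succ
      · have key : v ^ c = (v ^ (c / D)) ^ D * v ^ (c % D) := by
          conv_lhs => rw [← Nat.div_add_mod c D]
          rw [pow_add, ← pow_mul, mul_comm D (c / D)]
        rw [key] at h1 h2
        refine Win.force (y := v ^ (c / D)) (by positivity) ?_ fun t ht1 ht2 => ?_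
        · exact win_of_pow_mul_pow (z := v ^ (c / D)) (v := v) (w := w) (c := c % D) (by simp)
            (by simp [hv]) (by simp [hw]) (by positivity) hv0 (Nat.mod_lt _ hDpos) h1 h2
        · have : c / D < D := Nat.div_lt_of_lt_mul hge
          exact ih (v := v) (w := t) (c := c / D) (by simp [hv]) (by simp) hv0
            (Nat.div_pos (by omega) hDpos) (by omega) ht1 ht2

/-- A number that is not a power of two lies strictly between two consecutive powers of two. -/
theorem two_pow_log_lt {u : ℕ} (hu : 0 < u) (h : ¬ ∃ e : ℕ, u = 2 ^ e) :
    2 ^ Nat.log 2 u < u ∧ u < 2 * 2 ^ Nat.log 2 u := by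
  refine ⟨lt_of_le_of_ne (Nat.pow_log_le_self 2 hu.ne') fun e => h ⟨_, e.symm⟩, ?_⟩
  rw [← pow_succ']
  exact Nat.lt_pow_succ_log_self one_lt_two u

theorem win_of_not_two_pow {k : ℕ} {l : List ℕ} {u : ℕ} (hl : u ∈ l) (hu : 0 < u)
    (h : ¬ ∃ e : ℕ, u = 2 ^ e) (hlt : u < 2 ^ (2 * 2 ^ 2 ^ k)) : Win (k + 2) l := by
  obtain ⟨h1, h2⟩ := two_pow_log_lt hu h
  have h0 : 0 < Nat.log 2 u := by
    rcases Nat.eq_zero_or_pos (Nat.log 2 u) with e | e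
    · rw [e] at h1 h2; omega
    · exact e
  have h3 : Nat.log 2 u < 2 * 2 ^ 2 ^ k := Nat.log_lt_of_lt_pow hu.ne' hlt
  -- The only legal answer to `2` is `2`, and `u` lies strictly between consecutive powers of it.
  refine Win.play (x := 2) two_pos fun r hr1 hr2 => ?_
  obtain rfl : r = 2 := by omega
  exact win_of_pow (v := 2) (by simp) (by simp [hl]) two_pos h0 h3 h1 h2

/-- An answer `v` to the integer `p`-th root of `u` gives `v ^ p * 2 ^ s < u < 2 * (v ^ p * 2 ^ s)`
with `s < p`; strictness is the hypothesis on `u`. After `2 ^ s` and `u / 2 ^ s` are played, either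
an answer fails to be exact, which is punished, or `w = u / 2 ^ s` violates `v ^ p`. -/
theorem win_of_ne_pow_mul_two_pow {k u p : ℕ} (hu : 0 < u) (hp : 0 < p) (hpk : p < 2 * 2 ^ 2 ^ k)
    (h : ∀ v s, v ^ p * 2 ^ s ≠ u) : Win (k + 4) [u] := by
  obtain ⟨x, hx1, hx2⟩ : ∃ x, x ^ p ≤ u ∧ u < (x + 1) ^ p := by
    have hex : ∃ x, u < (x + 1) ^ p :=
      ⟨u, (Nat.lt_succ_self u).trans_le (Nat.le_self_pow hp.ne' _)⟩
    refine ⟨Nat.find hex, ?_, Nat.find_spec hex⟩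
    rcases Nat.eq_zero_or_pos (Nat.find hex) with e | e
    · rw [e, zero_pow hp.ne']; exact Nat.zero_le _
    · have := Nat.find_min hex (Nat.sub_lt e one_pos)
      rwa [show Nat.find hex - 1 + 1 = Nat.find hex by omega, not_lt] at this
  have hx0 : 0 < x := by
    rcases Nat.eq_zero_or_pos x with rfl | e
    · simp at hx2; omega
    · exact e
  refine Win.play hx0 fun v hv1 hv2 => ?_
  have hv0 : 0 < v := by omega
  have hvp : 0 < v ^ p := by positivity
  have hle : v ^ p ≤ u := (Nat.pow_le_pow_left hv1 p).trans hx1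
  have hlt : u < 2 ^ p * v ^ p := by
    rw [← mul_pow]
    exact hx2.trans_le (Nat.pow_le_pow_left (by omega) p)
  set s := Nat.log 2 (u / v ^ p) with hs
  have hq : 0 < u / v ^ p := Nat.div_pos hle hvp
  have hs1 : v ^ p * 2 ^ s < u := by
    refine lt_of_le_of_ne ?_ (h v s)
    rw [mul_comm]
    exact (Nat.le_div_iff_mul_le hvp).1 (Nat.pow_log_le_self 2 hq.ne')
  have hs2 : u < 2 * (v ^ p * 2 ^ s) := by
    have := (Nat.div_lt_iff_lt_mul hvp).1 (Nat.lt_pow_succ_log_self one_lt_two (u / v ^ p))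
    rw [← hs, pow_succ] at this
    linarith
  have hsp : s < p := Nat.log_lt_of_lt_pow hq.ne' ((Nat.div_lt_iff_lt_mul hvp).2 hlt)
  refine Win.play (x := 2 ^ s) (by positivity) fun z hz1 hz2 => ?_
  by_cases hz : z = 2 ^ s
  · subst hz
    have hle2 : 2 ^ s ≤ u := le_trans (Nat.le_mul_of_pos_left _ hvp) hs1.le
    have hz0 : 0 < 2 ^ s := by positivity
    refine Win.play (x := u / 2 ^ s) (Nat.div_pos hle2 hz0) fun w hw1 hw2 => ?_
    have h3 : 2 ^ s * w ≤ u :=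
      (Nat.mul_le_mul_left _ hw1).trans (Nat.mul_div_le u (2 ^ s))
    have h4 : u < 2 * (2 ^ s * w) := by
      have := (Nat.div_lt_iff_lt_mul hz0).1 hw2
      linarith
    rcases h3.lt_or_eq with h3 | h3
    · exact win_of_mem (a := 2 ^ s) (b := w) (c := u) (by simp) (by simp) (by simp) h3 h4 _
    · rw [← h3, mul_comm] at hs1 hs2
      refine win_of_pow (v := v) (w := w) (by simp) (by simp) hv0 hp hpk
        (lt_of_mul_lt_mul_left hs1 hz0.le) ?_
      refine lt_of_mul_lt_mul_left (a := 2 ^ s) ?_ hz0.le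
      linarith
  -- An answer other than `2 ^ s` is not a power of `2`, and it is small because `s < p`.
  · refine win_of_not_two_pow (u := z) (by simp) (by omega) ?_ ?_
    · rintro ⟨e, rfl⟩
      rw [← pow_succ'] at hz2
      have h5 := (Nat.pow_lt_pow_iff_right one_lt_two).1 hz2
      have h6 := (Nat.pow_le_pow_iff_right one_lt_two).1 hz1
      exact hz (by congr 1; omega)
    · exact hz1.trans_lt (Nat.pow_lt_pow_right one_lt_two (by omega))

theorem win_six_pow_factorial (k : ℕ) : Win (k + 4) [6 ^ (2 ^ 2 ^ k).factorial] := by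
  -- A prime above `2 ^ 2 ^ k` does not divide the factorial, which is the exponent of `3` in `u`;
  -- so `u` is not `v ^ p * 2 ^ s`.
  obtain ⟨p, hp, h1, h2⟩ := Nat.exists_prime_lt_and_le_two_mul (2 ^ 2 ^ k) (by positivity)
  have hne : p ≠ 2 * 2 ^ 2 ^ k := by
    rintro rfl
    exact Nat.not_prime_mul (by norm_num) (Nat.one_lt_two_pow (by positivity)).ne' hp
  refine win_of_ne_pow_mul_two_pow (p := p) (by positivity) hp.pos (by omega) fun v s e => ?_
  have hv : v ≠ 0 := by
    rintro rfl
    rw [zero_pow hp.ne_zero, zero_mul] at e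
    exact absurd e.symm (by positivity)
  have hfac := congrArg (padicValNat 3) e
  have : Fact (Nat.Prime 3) := ⟨Nat.prime_three⟩
  have h32 : padicValNat 3 2 = 0 := padicValNat.eq_zero_of_not_dvd (by norm_num)
  have h36 : padicValNat 3 6 = 1 := by
    rw [show 6 = 2 * 3 from rfl, padicValNat.mul (by norm_num) (by norm_num), h32]
    simp
  rw [padicValNat.mul (pow_ne_zero _ hv) (by positivity), padicValNat.pow,
    padicValNat.pow, padicValNat.pow, h32, h36] at hfac
  have : p ∣ (2 ^ 2 ^ k).factorial := ⟨padicValNat 3 v, by omega⟩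
  rw [hp.dvd_factorial] at this
  omega

/-! ### Finiteness, the intermediate value step and small complexities -/

theorem exists_win {u : ℕ} (hu : 0 < u) (h : ¬ ∃ e : ℕ, u = 2 ^ e) : ∃ n, Win n [u] := by
  refine ⟨u + 2, win_of_not_two_pow (by simp) hu h ?_⟩
  have h1 : u < 2 ^ u := Nat.lt_two_pow_self
  have h2 : 2 ^ u < 2 ^ 2 ^ u := Nat.lt_two_pow_self
  exact h1.trans (Nat.pow_lt_pow_right one_lt_two (by omega))

/-- The intermediate value step: the complexity of a number exceeds the complexities of the
smaller numbers that are not powers of two by at most one. -/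
theorem win_succ_of_forall_lt {n u : ℕ} (hn : 2 ≤ n) (hu : 3 < u) (h : ¬ ∃ e : ℕ, u = 2 ^ e)
    (ih : ∀ w, 0 < w → w < u → (¬ ∃ e : ℕ, w = 2 ^ e) → Win n [w]) : Win (n + 1) [u] := by
  obtain ⟨h1, h2⟩ := two_pow_log_lt (by omega) h
  set e := Nat.log 2 u with he
  have hle : 2 ^ (e / 2) ≤ 2 ^ e := Nat.pow_le_pow_right two_pos (by omega)
  refine Win.play (x := 2 ^ (e / 2)) (by positivity) fun r hr1 hr2 => ?_
  by_cases hr : ∃ e, r = 2 ^ e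
  · obtain rfl : r = 2 ^ (e / 2) := by
      obtain ⟨f, rfl⟩ := hr
      rw [← pow_succ'] at hr2
      have h5 := (Nat.pow_lt_pow_iff_right one_lt_two).1 hr2
      have h6 := (Nat.pow_le_pow_iff_right one_lt_two).1 hr1
      congr 1; omega
    -- For even `e` the square of `2 ^ (e / 2)` is violated by `u`. For odd `e` two more rounds
    -- supply `2` and the other factor `2 ^ (e / 2 + 1)`.
    obtain hpar | hpar : e = e / 2 + e / 2 ∨ e = e / 2 + (e / 2 + 1) := by omega
    · rw [hpar, pow_add] at h1 h2
      exact win_of_mem (a := 2 ^ (e / 2)) (b := 2 ^ (e / 2)) (c := u) (by simp) (by simp) (by simp)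
        h1 h2 _
    · refine Win.of_le hn ?_
      refine Win.play (x := 2) two_pos fun t ht1 ht2 => ?_
      obtain rfl : t = 2 := by omega
      refine Win.force (y := 2 ^ (e / 2 + 1)) (by positivity) ?_ fun z hz1 hz2 => ?_
      · rw [hpar, pow_add] at h1 h2
        exact win_of_mem (a := 2 ^ (e / 2)) (b := 2 ^ (e / 2 + 1)) (c := u) (by simp) (by simp)
          (by simp) h1 h2 _
      · rw [pow_succ] at hz1 hz2
        exact win_of_mem (a := 2 ^ (e / 2)) (b := 2) (c := z) (by simp) (by simp) (by simp)
          hz1 hz2 _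
  · exact (ih r (by omega) (by omega) hr).mono (by simp)

theorem not_win_zero {u : ℕ} (hu : 0 < u) : ¬ Win 0 [u] := by
  intro h
  obtain ⟨a, ha, b, hb, c, hc, h1, h2⟩ := challengerWins_iff.1 h
  simp only [List.mem_singleton] at ha hb hc
  subst ha hb hc
  nlinarith

theorem win_one_five : Win 1 [5] := by
  refine Win.play (x := 2) two_pos fun r h1 h2 => ?_
  obtain rfl : r = 2 := by omega
  exact win_of_mem (a := 2) (b := 2) (c := 5) (by simp) (by simp) (by simp) (by norm_num)
    (by norm_num) _

theorem win_two_three : Win 2 [3] :=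
  win_of_not_two_pow (k := 0) (u := 3) (by simp) (by norm_num)
    (by rintro ⟨e, he⟩; rcases e with _ | _ | e <;> simp [pow_succ] at he; omega) (by norm_num)

theorem not_win_one_three : ¬ Win 1 [3] := by
  rintro ⟨x, hx, h⟩
  -- The only danger is an answer strictly between `3 * 3` and `2 * (3 * 3)`; moves in that range
  -- are answered by `9`.
  obtain ⟨r, h1, h2, h3, h4⟩ : ∃ r, r ≤ x ∧ x < 2 * r ∧ 0 < r ∧ ¬ (9 < r ∧ r < 18) := by
    by_cases hc : 9 < x ∧ x < 18
    · exact ⟨9, by omega, by omega, by norm_num, by omega⟩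
    · exact ⟨x, le_rfl, by omega, hx, hc⟩
  obtain ⟨a, ha, b, hb, c, hc, h5, h6⟩ := challengerWins_iff.1 (h r h1 h2)
  simp only [List.cons_append, List.nil_append, List.mem_cons, List.not_mem_nil, or_false]
    at ha hb hc
  rcases ha with ha | ha <;> rcases hb with hb | hb <;> rcases hc with hc | hc <;>
    rw [ha, hb, hc] at h5 h6 <;>
    first
    | omega
    | nlinarith
    | (rcases (by omega : r = 1 ∨ 2 ≤ r) with rfl | h7
       · omega
       · nlinarith)

/-! ### Strategies of Powerator -/

/-- `Comb v L p q`: the pair `(p, q)` is an integer combination of the pairs in `v` with the sum of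
the absolute values of the coefficients at most `L`. -/
def Comb : List (ℕ × ℕ) → ℕ → ℤ → ℤ → Prop
  | [], _, p, q => p = 0 ∧ q = 0
  | (a, b) :: v, L, p, q => ∃ c : ℤ, c.natAbs ≤ L ∧ Comb v (L - c.natAbs) (p - c * a) (q - c * b)

namespace Comb

theorem zero {v : List (ℕ × ℕ)} : ∀ {L : ℕ}, Comb v L 0 0 := by
  induction v with
  | nil => exact ⟨rfl, rfl⟩
  | cons ab v ih => exact ⟨0, by simp, by simpa using ih⟩

theorem mono {v : List (ℕ × ℕ)} : ∀ {L L' : ℕ} {p q : ℤ}, L ≤ L' → Comb v L p q →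
    Comb v L' p q := by
  induction v with
  | nil => exact fun _ h => h
  | cons ab v ih =>
    rintro L L' p q hL ⟨c, hc, h⟩
    exact ⟨c, hc.trans hL, ih (by omega) h⟩

/-- This is the numerator in the comparison of two fractions of combinations, with control of its
length. -/
theorem sub {v : List (ℕ × ℕ)} (d d' : ℕ) : ∀ {L L' : ℕ} {p q p' q' : ℤ}, Comb v L p q →
    Comb v L' p' q' → Comb v (d * L + d' * L') (d * p - d' * p') (d * q - d' * q') := by
  induction v with
  | nil =>
    rintro L L' p q p' q' ⟨rfl, rfl⟩ ⟨rfl, rfl⟩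
    simp [Comb]
  | cons ab v ih =>
    rintro L L' p q p' q' ⟨c, hc, h⟩ ⟨c', hc', h'⟩
    have hn : (d * c - d' * c' : ℤ).natAbs ≤ d * c.natAbs + d' * c'.natAbs := by
      refine (Int.natAbs_sub_le _ _).trans (le_of_eq ?_)
      simp [Int.natAbs_mul]
    have h1 : d * c.natAbs + d * (L - c.natAbs) = d * L := by
      rw [← mul_add, Nat.add_sub_cancel' hc]
    have h2 : d' * c'.natAbs + d' * (L' - c'.natAbs) = d' * L' := by
      rw [← mul_add, Nat.add_sub_cancel' hc']
    refine ⟨d * c - d' * c', by omega, ?_⟩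
    have := (ih h h').mono (L' := d * L + d' * L' - (d * c - d' * c' : ℤ).natAbs) (by omega)
    convert this using 1 <;> ring

theorem neg {v : List (ℕ × ℕ)} {L : ℕ} {p q : ℤ} (h : Comb v L p q) : Comb v L (-p) (-q) := by
  simpa using sub 0 1 (zero (L := 0)) h

theorem of_mem {v : List (ℕ × ℕ)} {x : ℕ × ℕ} (h : x ∈ v) : Comb v 1 x.1 x.2 := by
  induction v with
  | nil => simp at h
  | cons ab v ih =>
    rcases List.mem_cons.1 h with rfl | h
    · exact ⟨1, by simp, by simpa using zero⟩
    · exact ⟨0, by simp, by simpa using ih h⟩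

theorem eq_zero {v : List (ℕ × ℕ)} : ∀ {p q : ℤ}, Comb v 0 p q → p = 0 ∧ q = 0 := by
  induction v with
  | nil => exact fun h => h
  | cons ab v ih =>
    rintro p q ⟨c, hc, h⟩
    obtain rfl : c = 0 := by simpa using hc
    simpa using ih h

theorem dvd {v : List (ℕ × ℕ)} {F : ℕ} (hF : ∀ x ∈ v, F ∣ x.2) : ∀ {L : ℕ} {p q : ℤ},
    Comb v L p q → (F : ℤ) ∣ q := by
  induction v with
  | nil =>
    rintro L p q ⟨-, rfl⟩
    exact dvd_zero _
  | cons ab v ih =>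
    rintro L p q ⟨c, -, h⟩
    have h1 := ih (fun x hx => hF x (List.mem_cons_of_mem _ hx)) h
    have h2 : (F : ℤ) ∣ ab.2 := Int.natCast_dvd_natCast.2 (hF ab List.mem_cons_self)
    exact (dvd_sub_left (h2.mul_left c)).1 h1

theorem finite (v : List (ℕ × ℕ)) : ∀ L : ℕ, {x : ℤ × ℤ | Comb v L x.1 x.2}.Finite := by
  induction v with
  | nil =>
    refine fun L => (Set.finite_singleton (0, 0)).subset ?_
    rintro ⟨p, q⟩ ⟨rfl, rfl⟩
    rfl
  | cons ab v ih =>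
    intro L
    refine ((Set.finite_Icc (-(L : ℤ)) L).biUnion fun c _ =>
      (ih (L - c.natAbs)).image fun x => (x.1 + c * ab.1, x.2 + c * ab.2)).subset ?_
    rintro ⟨p, q⟩ ⟨c, hc, h⟩
    refine Set.mem_biUnion (x := c) ⟨by omega, by omega⟩ ⟨(p - c * ab.1, q - c * ab.2), h, ?_⟩
    simp

end Comb

/-! ### Inserting a new response into a chain of points -/

/-- Given finitely many points `(A, B)` such that a larger `B` comes with a much larger `A`, any
`ξ ≥ 0` is attained up to rounding by a point `a + b * t` that is comparable with all of them. -/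
theorem exists_insert {T : Set (ℝ × ℤ)} (hT : T.Finite) {K : ℝ} {F : ℕ} {t ξ : ℝ} (hK : 0 ≤ K)
    (hF : 0 < F) (ht0 : 0 ≤ t) (ht : t ≤ 2) (hξ : 0 ≤ ξ) (h0 : ((0 : ℝ), (0 : ℤ)) ∈ T)
    (hdvd : ∀ x ∈ T, (F : ℤ) ∣ x.2)
    (hgap : ∀ x ∈ T, ∀ y ∈ T, x.2 < y.2 → x.1 + (2 * K + 2 * F + 1) ≤ y.1) :
    ∃ a b : ℕ, F ∣ b ∧ (a + b * t : ℝ) ≤ ξ ∧ ξ < a + b * t + 1 ∧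
      ∀ x ∈ T, (x.2 < b → x.1 + K ≤ a) ∧ ((b : ℤ) < x.2 → a + K ≤ x.1) := by
  set G : ℝ := 2 * K + 2 * F + 1 with hG
  have hF' : (1 : ℝ) ≤ F := by exact_mod_cast hF
  have castmul : ∀ {m n : ℤ}, m ≤ n → (m : ℝ) * t ≤ n * t := fun h =>
    mul_le_mul_of_nonneg_right (by exact_mod_cast h) ht0
  -- it suffices to find `b` with `a = ⌊ξ - b * t⌋`
  suffices hs : ∃ b : ℤ, 0 ≤ b ∧ (F : ℤ) ∣ b ∧
      ∀ x ∈ T, (x.2 < b → x.1 + K ≤ ⌊ξ - b * t⌋) ∧ (b < x.2 → ⌊ξ - b * t⌋ + K ≤ x.1) by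
    obtain ⟨b, hb0, hFb, hb⟩ := hs
    have ha0 : 0 ≤ ⌊ξ - b * t⌋ := by
      -- For `b > 0`, nonnegativity of `a` comes from comparison with the point `(0, 0)` of `T`.
      rcases hb0.lt_or_eq with h | rfl
      · have := (hb _ h0).1 h
        have h' : (0 : ℝ) ≤ (⌊ξ - b * t⌋ : ℤ) := by simp only at this; linarith
        exact_mod_cast h'
      · simpa using Int.floor_nonneg.2 hξ
    obtain ⟨a, ha⟩ := Int.eq_ofNat_of_zero_le ha0
    obtain ⟨b, rfl⟩ := Int.eq_ofNat_of_zero_le hb0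
    have h1 := Int.floor_le (ξ - ((b : ℤ) : ℝ) * t)
    have h2 := Int.lt_floor_add_one (ξ - ((b : ℤ) : ℝ) * t)
    rw [ha] at h1 h2 hb
    push_cast at h1 h2 hb
    exact ⟨a, b, Int.natCast_dvd_natCast.1 hFb, by linarith, by linarith, hb⟩
  have hfl : ∀ b : ℤ, (⌊ξ - b * t⌋ : ℝ) ≤ ξ - b * t ∧ ξ - b * t < ⌊ξ - b * t⌋ + 1 := fun b =>
    ⟨Int.floor_le _, Int.lt_floor_add_one _⟩
  -- By the gap condition, points of `T` are ordered alike by `B` and by `A + B * t`. So only the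
  -- neighbours of `ξ` matter: `x1` at or below it and `x2`, if any, above it.
  obtain ⟨x1, ⟨hx1, hx1ξ⟩, hmax⟩ := Set.exists_max_image {x ∈ T | x.1 + x.2 * t ≤ ξ}
    (fun x => x.1 + x.2 * t) (hT.subset fun _ h => h.1) ⟨(0, 0), h0, by simpa using hξ⟩
  have hlow : ∀ x ∈ T, x.1 + x.2 * t ≤ ξ → x.2 ≤ x1.2 := by
    intro x hx hxξ
    by_contra! h
    have h1 := hgap _ hx1 _ hx h
    have h2 := castmul h.le
    have h3 := hmax x ⟨hx, hxξ⟩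
    linarith
  have hlow1 : ∀ x ∈ T, x.1 + x.2 * t ≤ ξ → x.1 ≤ x1.1 := by
    intro x hx hxξ
    rcases (hlow x hx hxξ).lt_or_eq with h | h
    · have := hgap _ hx _ hx1 h
      linarith
    · have h3 := hmax x ⟨hx, hxξ⟩
      simp only [h] at h3
      linarith
  have hup : ∀ x ∈ T, ξ < x.1 + x.2 * t → x1.2 ≤ x.2 := by
    intro x hx hxξ
    by_contra! h
    have h1 := hgap _ hx _ hx1 h
    have h2 := castmul h.le
    linarith
  have hx10 : 0 ≤ x1.2 := hlow _ h0 (by simpa using hξ)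
  by_cases hne : {x ∈ T | ξ < x.1 + x.2 * t}.Nonempty
  swap
  · have hall : ∀ x ∈ T, x.1 + x.2 * t ≤ ξ := fun x hx => by
      by_contra! h
      exact hne ⟨x, hx, h⟩
    refine ⟨x1.2, hx10, hdvd _ hx1, fun x hx => ⟨fun h => ?_, fun h => ?_⟩⟩
    · have h1 := hgap _ hx _ hx1 h
      have h2 := (hfl x1.2).2
      linarith
    · exact absurd (hlow x hx (hall x hx)) (not_le.2 h)
  obtain ⟨x2, ⟨hx2, hx2ξ⟩, hmin⟩ := Set.exists_min_image {x ∈ T | ξ < x.1 + x.2 * t}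
    (fun x => x.1 + x.2 * t) (hT.subset fun _ h => h.1) hne
  have hupp : ∀ x ∈ T, ξ < x.1 + x.2 * t → x2.2 ≤ x.2 := by
    intro x hx hxξ
    by_contra! h
    have h1 := hgap _ hx _ hx2 h
    have h2 := castmul h.le
    have h3 := hmin x ⟨hx, hxξ⟩
    linarith
  have hupp1 : ∀ x ∈ T, ξ < x.1 + x.2 * t → x2.1 ≤ x.1 := by
    intro x hx hxξ
    rcases (hupp x hx hxξ).lt_or_eq with h | h
    · have := hgap _ hx2 _ hx h
      linarith
    · have h3 := hmin x ⟨hx, hxξ⟩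
      simp only [h] at h3
      linarith
  have h12 : x1.2 ≤ x2.2 := hup _ hx2 hx2ξ
  -- Start at `b = x1.2` and raise `b` in steps of `F` until `b` reaches `x2.2` or `a` lies at least
  -- `K` below `x2.1`.
  have hex : ∃ j : ℕ, x2.2 ≤ x1.2 + F * j ∨
      (⌊ξ - (x1.2 + F * j : ℤ) * t⌋ : ℝ) ≤ x2.1 - K := by
    refine ⟨(x2.2 - x1.2).toNat, Or.inl ?_⟩
    have : (1 : ℤ) * (x2.2 - x1.2).toNat ≤ F * (x2.2 - x1.2).toNat :=
      mul_le_mul_of_nonneg_right (by exact_mod_cast hF) (by positivity)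
    omega
  set j := Nat.find hex with hj
  have hspec := Nat.find_spec hex
  rw [← hj] at hspec
  set b : ℤ := x1.2 + F * j with hb
  have hb1 : x1.2 ≤ b := by
    have : (0 : ℤ) ≤ F * j := by positivity
    omega
  have hFb : (F : ℤ) ∣ b := dvd_add (hdvd _ hx1) (dvd_mul_right _ _)
  have hprev : x1.2 < b → b ≤ x2.2 ∧ x1.2 < x2.2 ∧
      x2.1 - K < ⌊ξ - (b - F : ℤ) * t⌋ := by
    intro hlt
    have hj0 : 0 < j := by
      rcases Nat.eq_zero_or_pos j with e | e
      · rw [hb, e] at hlt; simp at hlt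
      · exact e
    have h1 := Nat.find_min hex (m := j - 1) (Nat.sub_lt hj0 one_pos)
    have h2 : x1.2 + F * ((j - 1 : ℕ) : ℤ) = b - F := by
      rw [hb]; push_cast [Nat.cast_sub hj0]; ring
    push Not at h1
    rw [h2] at h1
    have h3 : (F : ℤ) ≤ x2.2 - (b - F) :=
      Int.le_of_dvd (by linarith [h1.1]) (dvd_sub (hdvd _ hx2) (dvd_sub hFb dvd_rfl))
    have h4 : (0 : ℤ) ≤ F * ((j - 1 : ℕ) : ℤ) := by positivity
    exact ⟨by linarith, by linarith [h1.1], h1.2⟩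
  have hb2 : b ≤ x2.2 := by
    rcases hb1.lt_or_eq with h | h
    · exact (hprev h).1
    · rw [← h]; exact h12
  refine ⟨b, hx10.trans hb1, hFb, fun x hx => ?_⟩
  by_cases hxξ : x.1 + x.2 * t ≤ ξ
  · refine ⟨fun h => ?_, fun h => ?_⟩
    · rcases hb1.lt_or_eq with h' | h'
      -- One step earlier `a` was above `x2.1 - K`. A step lowers it by less than `2 * F + 1`, since
      -- `t ≤ 2`, so the gap still leaves `a` at least `K` above `x1.1`.
      · obtain ⟨-, h2, h3⟩ := hprev h'
        have h4 := hgap _ hx1 _ hx2 h2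
        have h5 := (hfl b).2
        have h6 := (hfl (b - F)).1
        have h7 := hlow1 x hx hxξ
        have h8 : (F : ℝ) * t ≤ F * 2 := mul_le_mul_of_nonneg_left ht (by positivity)
        push_cast at h3 h6
        linarith
      · rw [← h'] at h ⊢
        have h1 := hgap _ hx _ hx1 h
        have h2 := (hfl x1.2).2
        linarith
    · exact absurd (hlow x hx hxξ) (not_le.2 (hb1.trans_lt h))
  · rw [not_le] at hxξ
    refine ⟨fun h => ?_, fun h => ?_⟩
    · exact absurd (hupp x hx hxξ) (not_le.2 (h.trans_le hb2))
    · rcases hspec with h1 | h1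
      · have hbe : b = x2.2 := le_antisymm hb2 h1
        rw [hbe] at h ⊢
        have h2 := hgap _ hx2 _ hx h
        have h3 := (hfl x2.2).1
        linarith
      · have := hupp1 x hx hxξ
        linarith

/-! ### Powerator's invariant and its bounds -/

/-- The divisibility of the exponents of `3` that Powerator needs with `m` rounds left. -/
def divBound : ℕ → ℕ
  | 0 => 1
  | m + 1 => divBound m * (2 ^ 2 ^ m).factorial

/-- The gap between exponents of `2` that Powerator needs with `m` rounds left. -/
def gapBound : ℕ → ℕ
  | 0 => 0
  | m + 1 => (2 ^ 2 ^ m) ^ 2 * (2 * gapBound m + 2 * divBound m + 1)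

/-- With `D = 2 ^ 2 ^ m`, the square of `D!` divides `(2 * D)!`, which divides `(D * D)!`. -/
theorem divBound_dvd (m : ℕ) : divBound m ∣ (2 ^ 2 ^ m).factorial := by
  induction m with
  | zero => exact one_dvd _
  | succ m ih =>
    refine (Nat.mul_dvd_mul_right ih _).trans ((Nat.factorial_mul_factorial_dvd_factorial_add _ _).trans
      (Nat.factorial_dvd_factorial ?_))
    have : 2 ≤ 2 ^ 2 ^ m := Nat.le_self_pow (by positivity) 2
    rw [two_pow_two_pow_succ]
    nlinarith

theorem divBound_pos (m : ℕ) : 0 < divBound m :=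
  Nat.pos_of_dvd_of_pos (divBound_dvd m) (Nat.factorial_pos _)

/-- The inductive step is `5 * D ^ 2 * D! ≤ (D + 3)! ≤ (D * D)!`, valid for `D ≥ 4`; the step from
`m = 0`, where `D = 2`, is computed. -/
theorem gapBound_le (m : ℕ) : gapBound m ≤ (2 ^ 2 ^ m).factorial := by
  induction m with
  | zero => exact Nat.zero_le _
  | succ m ih =>
    rcases Nat.eq_zero_or_pos m with rfl | hm
    · decide
    have hF := Nat.le_of_dvd (Nat.factorial_pos _) (divBound_dvd m)
    have h4 : 4 ≤ 2 ^ 2 ^ m := by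
      calc 4 = 2 ^ 2 ^ 1 := by norm_num
        _ ≤ 2 ^ 2 ^ m := Nat.pow_le_pow_right two_pos (Nat.pow_le_pow_right two_pos hm)
    rw [gapBound, two_pow_two_pow_succ]
    set D := 2 ^ 2 ^ m
    have hpos := Nat.factorial_pos D
    calc D ^ 2 * (2 * gapBound m + 2 * divBound m + 1) ≤ D ^ 2 * (5 * D.factorial) :=
          Nat.mul_le_mul_left _ (by omega)
      _ ≤ (D + 2 + 1) * ((D + 1 + 1) * ((D + 1) * D.factorial)) := by
          have : D ^ 2 * 5 ≤ (D + 2 + 1) * ((D + 1 + 1) * (D + 1)) := by nlinarith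
          calc _ = D ^ 2 * 5 * D.factorial := by ring
            _ ≤ (D + 2 + 1) * ((D + 1 + 1) * (D + 1)) * D.factorial := Nat.mul_le_mul_right _ this
            _ = _ := by ring
      _ = (D + 3).factorial := by
          rw [Nat.factorial_succ, Nat.factorial_succ, Nat.factorial_succ]
      _ ≤ (D * D).factorial := Nat.factorial_le (by nlinarith)

/-- The invariant of Powerator with `m` rounds left, where `(a, b)` stands for the response
`2 ^ a * 3 ^ b`. -/
def Inv (m : ℕ) (v : List (ℕ × ℕ)) : Prop :=
  (∀ x ∈ v, divBound m ∣ x.2) ∧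
    ∀ p q : ℤ, Comb v (2 ^ 2 ^ m + 1) p q → 0 < q → (gapBound m : ℤ) ≤ p

theorem inv_singleton {m N : ℕ} (hd : divBound m ∣ N) (hg : gapBound m ≤ N) :
    Inv m [(N, N)] := by
  refine ⟨by simpa using hd, ?_⟩
  rintro p q ⟨c, -, h1, h2⟩ hq
  have hpq : p = q := by linarith
  have hNq : (N : ℤ) ∣ q := ⟨c, by linarith⟩
  have := Int.le_of_dvd hq hNq
  rw [hpq]
  exact le_trans (by exact_mod_cast hg) this

theorem logb_three_le : Real.logb 2 3 ≤ 2 := by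
  rw [Real.logb_le_iff_le_rpow one_lt_two (by norm_num)]
  norm_num

theorem logb_two_pow_mul_three_pow (a b : ℕ) :
    Real.logb 2 (((2 ^ a * 3 ^ b : ℕ)) : ℝ) = a + b * Real.logb 2 3 := by
  push_cast
  rw [Real.logb_mul (by positivity) (by positivity), Real.logb_pow, Real.logb_pow,
    Real.logb_self_eq_one one_lt_two, mul_one]

/-- A combination that uses `(a, b)` with coefficient `±d` compares `(a, b)` with a cut `(p / d, q /
d)`, where `(p, q)` is a combination of the old vectors of length at most `D + 1 - d`. The old
invariant, at length `D ^ 2 + 1`, separates the cuts from each other, so `exists_insert` applies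
with `t = log₂ 3` and `ξ = log₂ x`. -/
theorem Inv.exists_cons {m : ℕ} {v : List (ℕ × ℕ)} (h : Inv (m + 1) v) {x : ℕ} (hx : 0 < x) :
    ∃ a b : ℕ, 2 ^ a * 3 ^ b ≤ x ∧ x < 2 * (2 ^ a * 3 ^ b) ∧ Inv m ((a, b) :: v) := by
  obtain ⟨hdiv, hgap⟩ := h
  rw [two_pow_two_pow_succ] at hgap
  rw [divBound] at hdiv
  set D := 2 ^ 2 ^ m with hD
  have hD0 : 0 < D := by positivity
  have hK1 : (gapBound (m + 1) : ℤ) = D ^ 2 * (2 * gapBound m + 2 * divBound m + 1) := by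
    rw [gapBound]; push_cast; rfl
  set K := gapBound m with hK
  set F := divBound m with hF
  have hF0 : 0 < F := divBound_pos m
  -- the cuts `p / d`, `q / d`
  set T : Set (ℝ × ℤ) := {y | ∃ (d : ℕ) (p : ℤ), 0 < d ∧ d ≤ D ∧ Comb v (D + 1 - d) p (d * y.2) ∧
    y.1 = p / d} with hT
  have hqdvd : ∀ {d L : ℕ} {p q : ℤ}, 0 < d → d ≤ D → Comb v L p q →
      ∃ B : ℤ, q = d * B ∧ (F : ℤ) ∣ B := by
    intro d L p q hd0 hdD hc
    -- The factor `D!` in `divBound (m + 1)` absorbs every denominator `d ≤ D`.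
    obtain ⟨e, he⟩ := Nat.dvd_factorial hd0 hdD
    obtain ⟨f, rfl⟩ := hc.dvd hdiv
    refine ⟨F * (e * f), ?_, dvd_mul_right _ _⟩
    rw [he]; push_cast; ring
  have hTfin : T.Finite := by
    refine ((Set.finite_Icc 1 D).biUnion fun d _ => (Comb.finite v (D + 1 - d)).image
      fun y => ((y.1 / d : ℝ), y.2 / (d : ℤ))).subset ?_
    rintro ⟨A, B⟩ ⟨d, p, hd0, hdD, hc, hA⟩
    refine Set.mem_biUnion (x := d) ⟨hd0, hdD⟩ ⟨(p, d * B), hc, ?_⟩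
    have : (d : ℤ) ≠ 0 := by exact_mod_cast hd0.ne'
    exact Prod.ext hA.symm (Int.mul_ediv_cancel_left _ this)
  have hT0 : ((0 : ℝ), (0 : ℤ)) ∈ T := ⟨1, 0, one_pos, hD0, by simpa using Comb.zero, by simp⟩
  have hTdvd : ∀ y ∈ T, (F : ℤ) ∣ y.2 := by
    rintro ⟨A, B⟩ ⟨d, p, hd0, hdD, hc, hA⟩
    obtain ⟨B', hB', hFB⟩ := hqdvd hd0 hdD hc
    have : (d : ℤ) ≠ 0 := by exact_mod_cast hd0.ne'
    rwa [mul_left_cancel₀ this hB']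
  have hTgap : ∀ y ∈ T, ∀ z ∈ T, y.2 < z.2 → y.1 + (2 * (K : ℝ) + 2 * F + 1) ≤ z.1 := by
    rintro ⟨A, B⟩ ⟨d, p, hd0, hdD, hc, hA⟩ ⟨A', B'⟩ ⟨d', p', hd0', hdD', hc', hA'⟩ hlt
    simp only at hc hc' hA hA' hlt ⊢
    have hcomb := Comb.sub d d' hc' hc
    -- With `d = s + 1`, `D = d + r` and likewise for `d'`, this reduces to `s * r' + s' * r ≤ (s +
    -- r) * (s' + r')`. Equality occurs at `d = 1`, `d' = D`.
    have hnorm : d * (D + 1 - d') + d' * (D + 1 - d) ≤ D * D + 1 := by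
      obtain ⟨s, rfl⟩ := Nat.exists_eq_add_of_le hd0
      obtain ⟨s', rfl⟩ := Nat.exists_eq_add_of_le hd0'
      obtain ⟨r, hr⟩ := Nat.exists_eq_add_of_le hdD
      obtain ⟨r', hr'⟩ := Nat.exists_eq_add_of_le hdD'
      have e1 : D + 1 - (Nat.succ 0 + s) = r + 1 := by omega
      have e2 : D + 1 - (Nat.succ 0 + s') = r' + 1 := by omega
      rw [e1, e2]
      have e3 : s + r = D - 1 := by omega
      have e4 : s' + r' = D - 1 := by omega
      obtain ⟨E, hE⟩ : ∃ E, D = E + 1 := ⟨D - 1, by omega⟩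
      rw [hE] at e3 e4 ⊢
      have e5 : s + r = E := by omega
      have e6 : s' + r' = E := by omega
      have e7 : E * E = s * s' + s * r' + r * s' + r * r' := by
        nth_rewrite 1 [← e5]; rw [← e6]; ring
      simp only [Nat.succ_eq_add_one, zero_add]
      have : 0 ≤ s * s' := Nat.zero_le _
      nlinarith [Nat.zero_le (r * r')]
    have hpos : (0 : ℤ) < d * (d' * B') - d' * (d * B) := by
      have : (0 : ℤ) < d * d' * (B' - B) :=
        mul_pos (by exact_mod_cast Nat.mul_pos hd0 hd0') (by linarith)
      linarith
    have h1 := hgap _ _ (hcomb.mono hnorm) hpos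
    rw [hK1] at h1
    have h2 : ((d : ℝ) * d') * (2 * K + 2 * F + 1) ≤ d * p' - d' * p := by
      have h3 : (D : ℝ) ^ 2 * (2 * K + 2 * F + 1) ≤ d * p' - d' * p := by exact_mod_cast h1
      have h4 : ((d : ℝ) * d') ≤ D ^ 2 := by
        rw [sq]; exact_mod_cast Nat.mul_le_mul hdD hdD'
      exact (mul_le_mul_of_nonneg_right h4 (by positivity)).trans h3
    have hd : (0 : ℝ) < d := by exact_mod_cast hd0
    have hd' : (0 : ℝ) < d' := by exact_mod_cast hd0'
    have h5 : A' - A = (d * p' - d' * p) / (d * d') := by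
      rw [hA, hA']; field_simp
    have h6 : 2 * (K : ℝ) + 2 * F + 1 ≤ A' - A := by
      rw [h5, le_div_iff₀ (by positivity)]; linarith
    linarith
  have hx1 : (1 : ℝ) ≤ x := by exact_mod_cast hx
  obtain ⟨a, b, hFb, h1, h2, hcut⟩ := exists_insert hTfin (K := K) (F := F) (t := Real.logb 2 3)
    (ξ := Real.logb 2 x) (by positivity) hF0 (Real.logb_nonneg one_lt_two (by norm_num))
    logb_three_le (Real.logb_nonneg one_lt_two hx1) hT0 hTdvd hTgap
  have hpos : (0 : ℝ) < (2 ^ a * 3 ^ b : ℕ) := by positivity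
  rw [← logb_two_pow_mul_three_pow] at h1 h2
  refine ⟨a, b, ?_, ?_, ?_, ?_⟩
  · exact_mod_cast (Real.logb_le_logb one_lt_two hpos (by positivity)).1 h1
  · have h3 : Real.logb 2 ((2 ^ a * 3 ^ b : ℕ) : ℝ) + 1 =
        Real.logb 2 ((2 * (2 ^ a * 3 ^ b) : ℕ) : ℝ) := by
      rw [Nat.cast_mul 2, Real.logb_mul (by norm_num) hpos.ne', Nat.cast_two,
        Real.logb_self_eq_one one_lt_two, add_comm]
    rw [h3] at h2
    exact_mod_cast (Real.logb_lt_logb_iff one_lt_two (by positivity) (by positivity)).1 h2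
  · intro y hy
    rcases List.mem_cons.1 hy with rfl | hy
    · exact hFb
    · exact (dvd_mul_right _ _).trans (hdiv y hy)
  · rintro p q ⟨c, hc, hcomb⟩ hq
    have hKK : (K : ℤ) ≤ gapBound (m + 1) := by
      rw [hK1]
      have : (1 : ℤ) ≤ D ^ 2 := by exact_mod_cast Nat.one_le_pow _ _ hD0
      nlinarith [Int.natCast_nonneg K, Int.natCast_nonneg F]
    -- cuts scaled back to combinations
    have hscale : ∀ {d : ℕ} {s : ℤ}, 0 < d → (K : ℝ) ≤ s / d → (K : ℤ) ≤ s := by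
      intro d s hd0 hs
      rw [le_div_iff₀ (by exact_mod_cast hd0)] at hs
      have h3 : (K : ℝ) ≤ s := le_trans
        (le_mul_of_one_le_right (by positivity) (by exact_mod_cast hd0)) hs
      exact_mod_cast h3
    -- If the new vector uses up the whole length `D + 1`, the combination is a multiple of it, and
    -- the cut `(0, 0)` suffices.
    obtain hcD | hcD : c.natAbs = D + 1 ∨ c.natAbs ≤ D := by omega
    · rw [hcD, Nat.sub_self] at hcomb
      obtain ⟨hp, hq'⟩ := hcomb.eq_zero
      have hcb : 0 < c * b := by linarith
      have hb0 : (0 : ℤ) < b := by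
        rcases (Int.natCast_nonneg b).lt_or_eq with h | h
        · exact h
        · rw [← h] at hcb; simp at hcb
      have hc0 : 0 < c := pos_of_mul_pos_left hcb hb0.le
      have h3 := (hcut _ hT0).1 hb0
      simp only [zero_add] at h3
      have h4 : (K : ℤ) ≤ a := by exact_mod_cast h3
      nlinarith
    · obtain ⟨d, rfl | rfl⟩ := c.eq_nat_or_neg
      · simp only [Int.natAbs_natCast] at hcD hcomb
        rcases Nat.eq_zero_or_pos d with rfl | hd0
        · refine hKK.trans (hgap p q ?_ hq)
          simpa using hcomb.mono (L' := D * D + 1) (by simp; nlinarith)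
        · have hneg := hcomb.neg
          obtain ⟨B, hB, -⟩ := hqdvd hd0 hcD hneg
          rw [hB] at hneg
          have hBb : B < b := by
            have : (d : ℤ) * B < d * b := by linarith
            exact lt_of_mul_lt_mul_left this (by positivity)
          have h3 := (hcut (((-(p - d * a) : ℤ) : ℝ) / d, B) ⟨d, _, hd0, hcD, hneg, rfl⟩).1 hBb
          refine hscale hd0 ?_
          have hd : (0 : ℝ) < d := by exact_mod_cast hd0
          have h4 : (((-(p - d * a) : ℤ) : ℝ) / d) = a - p / d := by
            push_cast; field_simp; ring
          simp only [h4] at h3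
          linarith
      · simp only [Int.natAbs_neg, Int.natAbs_natCast] at hcD hcomb
        rcases Nat.eq_zero_or_pos d with rfl | hd0
        · refine hKK.trans (hgap p q ?_ hq)
          simpa using hcomb.mono (L' := D * D + 1) (by simp; nlinarith)
        · obtain ⟨B, hB, -⟩ := hqdvd hd0 hcD hcomb
          rw [hB] at hcomb
          have hBb : (b : ℤ) < B := by
            have : (d : ℤ) * b < d * B := by linarith
            exact lt_of_mul_lt_mul_left this (by positivity)
          have h3 := (hcut (((p - -(d : ℤ) * a : ℤ) : ℝ) / d, B) ⟨d, _, hd0, hcD, hcomb, rfl⟩).2 hBb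
          refine hscale hd0 ?_
          have hd : (0 : ℝ) < d := by exact_mod_cast hd0
          have h4 : ((p - -(d : ℤ) * a : ℤ) : ℝ) / d = a + p / d := by
            push_cast; field_simp; ring
          simp only [h4] at h3
          linarith

/-- The vector of `u_h / (u_i u_j)` is a combination of length `3 = 2 ^ 2 ^ 0 + 1`. By the invariant
its coordinates do not have opposite signs, and a nonzero exponent of `3` puts the quotient outside
the interval from `1` to `2`. -/
theorem Inv.not_win_zero {v : List (ℕ × ℕ)} (h : Inv 0 v) :
    ¬ Win 0 (v.map fun x => 2 ^ x.1 * 3 ^ x.2) := by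
  intro hw
  obtain ⟨_, ha, _, hb, _, hc, h1, h2⟩ := challengerWins_iff.1 hw
  obtain ⟨x, hx, rfl⟩ := List.mem_map.1 ha
  obtain ⟨y, hy, rfl⟩ := List.mem_map.1 hb
  obtain ⟨z, hz, rfl⟩ := List.mem_map.1 hc
  have hcomb := Comb.sub 1 1 (Comb.sub 1 1 (Comb.of_mem hz) (Comb.of_mem hx)) (Comb.of_mem hy)
  have e : 2 ^ x.1 * 3 ^ x.2 * (2 ^ y.1 * 3 ^ y.2) = 2 ^ (x.1 + y.1) * 3 ^ (x.2 + y.2) := by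
    rw [pow_add, pow_add]; ring
  rw [e] at h1 h2
  have hinv := h.2 _ _ hcomb
  have hinv' := h.2 _ _ hcomb.neg
  simp only [gapBound] at hinv hinv'
  push_cast at hinv hinv'
  rcases lt_trichotomy z.2 (x.2 + y.2) with hlt | heq | hgt
  · have hle : z.1 ≤ x.1 + y.1 := by
      have := hinv' (by linarith)
      omega
    exact absurd h1 (not_lt.2 (Nat.mul_le_mul (Nat.pow_le_pow_right two_pos hle)
      (Nat.pow_le_pow_right three_pos hlt.le)))
  · rw [heq] at h1 h2
    have h3 := lt_of_mul_lt_mul_right h1 (Nat.zero_le _)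
    rw [← mul_assoc, ← pow_succ'] at h2
    have h4 := lt_of_mul_lt_mul_right h2 (Nat.zero_le _)
    have h5 := (Nat.pow_lt_pow_iff_right one_lt_two).1 h3
    have h6 := (Nat.pow_lt_pow_iff_right one_lt_two).1 h4
    omega
  · have hle : x.1 + y.1 ≤ z.1 := by
      have := hinv (by linarith)
      omega
    have h3 : 2 ^ (x.1 + y.1) * 3 ^ (x.2 + y.2 + 1) ≤ 2 ^ z.1 * 3 ^ z.2 :=
      Nat.mul_le_mul (Nat.pow_le_pow_right two_pos hle) (Nat.pow_le_pow_right three_pos hgt)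
    rw [pow_succ] at h3
    nlinarith

theorem Inv.not_win {m : ℕ} : ∀ {v : List (ℕ × ℕ)}, Inv m v →
    ¬ Win m (v.map fun x => 2 ^ x.1 * 3 ^ x.2) := by
  induction m with
  | zero => exact fun h => h.not_win_zero
  | succ m ih =>
    rintro v h ⟨x, hx, hw⟩
    obtain ⟨a, b, h1, h2, hinv⟩ := h.exists_cons hx
    refine ih hinv ((hw _ h1 h2).mono ?_)
    intro y
    simp only [List.mem_append, List.map_cons, List.mem_cons, List.not_mem_nil, or_false]
    tauto

/-! ### Lower bound, unboundedness and the set of values -/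

theorem not_win_six_pow_factorial (k : ℕ) : ¬ Win k [6 ^ (2 ^ 2 ^ k).factorial] := by
  have := (inv_singleton (divBound_dvd k) (gapBound_le k)).not_win
  rwa [List.map_singleton, ← mul_pow] at this

theorem six_pow_ne_two_pow {N : ℕ} (hN : 0 < N) : ¬ ∃ e : ℕ, 6 ^ N = 2 ^ e := by
  rintro ⟨e, he⟩
  have h3 : 3 ∣ 2 ^ e := he ▸ dvd_pow (by norm_num) hN.ne'
  exact absurd (Nat.prime_three.dvd_of_dvd_pow h3) (by norm_num)

theorem exists_not_win (N : ℕ) :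
    ∃ u : ℕ, 0 < u ∧ (¬ ∃ e : ℕ, u = 2 ^ e) ∧ ¬ Win N [u] :=
  ⟨_, by positivity, six_pow_ne_two_pow (Nat.factorial_pos _), not_win_six_pow_factorial N⟩

theorem exists_complexity_eq (n : ℕ) :
    ∃ u : ℕ, 0 < u ∧ (¬ ∃ e : ℕ, u = 2 ^ e) ∧ Win (n + 1) [u] ∧ ¬ Win n [u] := by
  classical
  match n with
  | 0 =>
    refine ⟨5, by norm_num, ?_, win_one_five, not_win_zero (by norm_num)⟩
    rintro ⟨e, he⟩
    rcases e with _ | e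
    · norm_num at he
    · rw [pow_succ] at he; omega
  | 1 =>
    refine ⟨3, by norm_num, ?_, win_two_three, not_win_one_three⟩
    rintro ⟨e, he⟩
    rcases e with _ | e
    · norm_num at he
    · rw [pow_succ] at he; omega
  | n + 2 =>
    -- The least `u` that resists `n + 2` rounds works, because all smaller candidates are lost for
    -- Powerator within `n + 2`.
    have hex := exists_not_win (n + 2)
    obtain ⟨u, ⟨h0, h1, h2⟩, hmin⟩ : ∃ u, (0 < u ∧ (¬ ∃ e : ℕ, u = 2 ^ e) ∧ ¬ Win (n + 2) [u]) ∧
        ∀ w < u, ¬ (0 < w ∧ (¬ ∃ e : ℕ, w = 2 ^ e) ∧ ¬ Win (n + 2) [w]) :=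
      ⟨Nat.find hex, Nat.find_spec hex, fun w => Nat.find_min hex⟩
    refine ⟨u, h0, h1, win_succ_of_forall_lt (by omega) ?_ h1 ?_, h2⟩
    · by_contra hle
      obtain rfl | rfl | rfl : u = 1 ∨ u = 2 ∨ u = 3 := by omega
      · exact h1 ⟨0, rfl⟩
      · exact h1 ⟨1, rfl⟩
      · exact h2 (win_two_three.of_le (by omega))
    · intro w hw0 hlt hw
      by_contra hwin
      exact hmin w hlt ⟨hw0, hw, hwin⟩

end PowG

theorem mainTheorem10 :
    (∀ k : ℕ,
      ((k + 1 : ℕ) : ℕ∞) ≤ PowG.complexity [6 ^ Nat.factorial (2 ^ 2 ^ k)] ∧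
      PowG.complexity [6 ^ Nat.factorial (2 ^ 2 ^ k)] ≤ ((k + 4 : ℕ) : ℕ∞)) ∧
    (∀ N : ℕ, ∃ u : ℕ, 0 < u ∧ (¬ ∃ e : ℕ, u = 2 ^ e) ∧ (N : ℕ∞) < PowG.complexity [u]) ∧
    {m : ℕ∞ | ∃ u : ℕ, 0 < u ∧ (¬ ∃ e : ℕ, u = 2 ^ e) ∧ m = PowG.complexity [u]} =
      {m : ℕ∞ | ∃ n : ℕ, 0 < n ∧ m = (n : ℕ∞)} := by
  refine ⟨fun k => ⟨PowG.succ_le_complexity (PowG.not_win_six_pow_factorial k),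
    PowG.complexity_le_iff.2 (PowG.win_six_pow_factorial k)⟩, fun N => ?_, ?_⟩
  · obtain ⟨u, h0, h1, h2⟩ := PowG.exists_not_win N
    exact ⟨u, h0, h1, PowG.lt_complexity_iff.2 h2⟩
  · ext m
    constructor
    · rintro ⟨u, h0, h1, rfl⟩
      obtain ⟨n, hn⟩ := PowG.exists_win h0 h1
      obtain ⟨c, hc⟩ := ENat.ne_top_iff_exists.1
        (ne_top_of_le_ne_top (ENat.natCast_ne_top n) (PowG.complexity_le_iff.2 hn))
      refine ⟨c, ?_, hc.symm⟩
      have := PowG.lt_complexity_iff.2 (PowG.not_win_zero h0)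
      rw [← hc] at this
      exact_mod_cast this
    · rintro ⟨n, hn, rfl⟩
      obtain ⟨n, rfl⟩ := Nat.exists_eq_succ_of_ne_zero hn.ne'
      obtain ⟨u, h0, h1, h2, h3⟩ := PowG.exists_complexity_eq n
      exact ⟨u, h0, h1, le_antisymm (PowG.succ_le_complexity h3) (PowG.complexity_le_iff.2 h2)⟩
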